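/- Let $G$ be a probability distribution on $\mathbb{Z}_+=\{0,1,2,\dots\}$ with mean $\mu_G$ and variance $\sigma_G^2$, and for $\theta\in[0,1]$ let $\mathbb{P}_{\theta}$ be the probability measure under which $(\varepsilon_t)_{t\ge1}$ are i.i.d. with distribution $G$, $(Z^{(t)}_j)_{j\ge1,t\ge1}$ are i.i.d. Bernoulli($\theta$) and independent of $(\varepsilon_t)_{t\ge1}$, and the INAR(1) process is defined by $X_0=0$ and $$X_t=\sum_{j=1}^{X_{t-1}}Z^{(t)}_j+\varepsilon_t,\qquad t\ge1 .$$ Define the ordinary least squares estimator of the autoregression parameter and the Dickey–Fuller t-statistic by $$\hat\theta_n^{\mathrm{OLS}}=\frac{\sum_{t=1}^nX_{t-1}(X_t-\mu_G)}{\sum_{t=1}^nX_{t-1}^2},\qquad \tau_n=\frac{\hat\theta_n^{\mathrm{OLS}}-1}{\sqrt{\sigma_G^2\left(\sum_{t=1}^nX_{t-1}^2\right)^{-1}}}$$ (with value $0$ for $\tau_n$, say, on the event $\sum_{t=1}^n X_{t-1}^2=0$, whose probability tends to $0$ below). For $\alpha\in(0,1)$ let the Dickey–Fuller test of $H_0:\theta=1$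 against $H_1:\theta<1$ reject $H_0$ if $\tau_n<z_\alpha$, where $z_\alpha$ is the $\alpha$-quantile of $N(0,1)$. **Proposition 4.5.** Assume $\mathbb{E}_G\varepsilon_1^3<\infty$ and $\sigma_G^2>0$. Then for all $h\ge0$, $$\tau_n\xrightarrow{d}N(0,1)\quad\text{under }\mathbb{P}_{1-h/n^2},$$ and, for every $\alpha\in(0,1)$, $$\lim_{n\to\infty}\mathbb{P}_{1-h/n^2}(\text{reject }H_0)=\alpha .$$ (Here $\mathbb{P}_{1-h/n^2}$ is considered for $n$ so large that $h\le n^2$.) In particular, the limiting rejection probability under the local alternatives $1-h/n^2$, $h>0$, equals that under the null hypothesis $h=0$. -/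

import Mathlib

open MeasureTheory ProbabilityTheory Filter Topology

namespace INAR

/-- Canonical sample space of the driving variables: a sample point is a pair `(e, z)`, where
`e t` is the value of the innovation `ε_{t+1}`, and `z (j, t)` is the value of the thinning
variable `Z_{j+1}^{(t+1)}` (all indices are shifted to start at `0`). -/
abbrev Space : Type := (ℕ → ℕ) × (ℕ × ℕ → ℕ)

/-- The probability measure `P_{θ,G}`: the innovations are i.i.d. with distribution `G`, the
thinning variables are i.i.d. Bernoulli with success probability `θ` (with values in `{0, 1}`),
and the two families are independent of each other. -/
noncomputable def law (θ : unitInterval) (G : Measure ℕ) [IsProbabilityMeasure G] :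
    Measure Space :=
  (Measure.infinitePi fun _ : ℕ => G).prod
    (Measure.infinitePi fun _ : ℕ × ℕ => bernoulliMeasure (1 : ℕ) 0 θ)

instance (θ : unitInterval) (G : Measure ℕ) [IsProbabilityMeasure G] :
    IsProbabilityMeasure (law θ G) := by
  unfold law
  infer_instance

/-- The INAR(1) process started at `0`:
`X_0 = 0` and `X_{t+1} = ∑_{j=1}^{X_t} Z_j^{(t+1)} + ε_{t+1}`. -/
def X : ℕ → Space → ℕ
  | 0, _ => 0
  | t + 1, ω => (∑ j ∈ Finset.range (X t ω), ω.2 (j, t)) + ω.1 t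

/-- Mean `μ_G` of the innovation distribution. -/
noncomputable def innovMean (G : Measure ℕ) : ℝ := ∫ k : ℕ, (k : ℝ) ∂G

/-- Variance `σ_G²` of the innovation distribution. -/
noncomputable def innovVar (G : Measure ℕ) : ℝ := variance (fun k : ℕ => (k : ℝ)) G

/-- The ordinary least squares estimator of the autoregression parameter (with `G` known),
`∑_{t=1}^n X_{t-1} (X_t - μ_G) / ∑_{t=1}^n X_{t-1}^2`. -/
noncomputable def olsEstimator (G : Measure ℕ) (n : ℕ) (ω : Space) : ℝ :=
  (∑ t ∈ Finset.range n, (X t ω : ℝ) * ((X (t + 1) ω : ℝ) - innovMean G)) /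
    ∑ t ∈ Finset.range n, (X t ω : ℝ) ^ 2

/-- The Dickey–Fuller t-statistic
`τ_n = (θ̂_n - 1) / √(σ_G² (∑_{t=1}^n X_{t-1}^2)⁻¹)`, with `θ̂_n` the OLS estimator. -/
noncomputable def dickeyFuller (G : Measure ℕ) (n : ℕ) (ω : Space) : ℝ :=
  (olsEstimator G n ω - 1) /
    √(innovVar G * (∑ t ∈ Finset.range n, (X t ω : ℝ) ^ 2)⁻¹)

/-- The `α`-quantile of the standard normal distribution. -/
noncomputable def normalQuantile (α : ℝ) : ℝ := sInf {x : ℝ | α ≤ cdf (gaussianReal 0 1) x}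

/-- Rejection event of the asymptotic level `α` Dickey–Fuller test of `H₀ : θ = 1` against
`H₁ : θ < 1` based on `X_0, …, X_n`: the statistic falls below the normal `α`-quantile. -/
def rejects (G : Measure ℕ) (α : ℝ) (n : ℕ) : Set Space :=
  {ω | dickeyFuller G n ω < normalQuantile α}

end INAR

namespace INAR

/-! ### Convergence in distribution: a weighted central limit theorem and transfer lemmas -/

/-! Without thinning the process is a random walk with drift `μ = μ_G > 0`, hence close to the line
`μ t`. When `1 - θ = h / n²`, about `h μ t / n²` individuals are lost at time `t`, so only `O(1)` in
expectation up to time `n`. Such a loss is invisible at the scale of the statistic, which is why `h`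
leaves no trace in the limit.

Write `τ_n = N / (σ √S)` with `S = ∑ X_t²` and `N = ∑ X_t (X_{t+1} - μ - X_t)`. The increment in `N`
is the centred innovation minus the loss. Replacing `X_t` by `μ t` and dropping the loss turns `N`
into `μ ∑ t (ε_{t+1} - μ)`, of order `n^{3/2}`, with an error of `L¹` norm `O(n)`
(`abs_olsNumerator_sub_le`, `integral_numeratorErr_le`). Likewise `S` is `μ² n³ / 3` up to an `L¹`
error `O(n^{5/2})` and a deterministic `O(n²)` (`abs_sum_X_sq_sub_le`,
`integral_denominatorErr_le`). The losses enter these bounds through `lossBound`, whose mean given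
the innovations is explicit (`integral_mul_lossBound`).

The leading term is a weighted i.i.d. sum with weights proportional to `t`, asymptotically normal by
`tendstoInDistribution_weighted_sum`; Slutsky's theorem then gives `τ_n`. The measure changes with
`n`, so convergence in probability is stated on the product of all the sample spaces. Rejection
probabilities converge because the normal law has no atoms. -/

lemma norm_prod_sub_prod_le_sum {ι : Type*} (s : Finset ι) (a b : ι → ℂ)
    (ha : ∀ i ∈ s, ‖a i‖ ≤ 1) (hb : ∀ i ∈ s, ‖b i‖ ≤ 1) :
    ‖∏ i ∈ s, a i - ∏ i ∈ s, b i‖ ≤ ∑ i ∈ s, ‖a i - b i‖ := by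
  classical
  induction s using Finset.induction_on with
  | empty => simp
  | insert i s his ih =>
    rw [Finset.prod_insert his, Finset.prod_insert his, Finset.sum_insert his]
    have h1 : ‖∏ j ∈ s, a j‖ ≤ 1 := by
      rw [norm_prod]
      exact Finset.prod_le_one (fun _ _ => norm_nonneg _)
        fun j hj => ha j (Finset.mem_insert_of_mem hj)
    have h2 := hb i (Finset.mem_insert_self i s)
    have h3 := ih (fun j hj => ha j (Finset.mem_insert_of_mem hj))
      (fun j hj => hb j (Finset.mem_insert_of_mem hj))
    calc ‖a i * ∏ j ∈ s, a j - b i * ∏ j ∈ s, b j‖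
        = ‖(a i - b i) * ∏ j ∈ s, a j + b i * (∏ j ∈ s, a j - ∏ j ∈ s, b j)‖ := by
          congr 1; ring
      _ ≤ ‖a i - b i‖ * ‖∏ j ∈ s, a j‖ + ‖b i‖ * ‖∏ j ∈ s, a j - ∏ j ∈ s, b j‖ := by
          refine (norm_add_le _ _).trans ?_
          rw [norm_mul, norm_mul]
      _ ≤ ‖a i - b i‖ * 1 + 1 * ∑ j ∈ s, ‖a j - b j‖ := by gcongr
      _ = _ := by ring

lemma isLittleO_charFun_sub_exp {Ω : Type*} {mΩ : MeasurableSpace Ω} {P : Measure Ω}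
    [IsProbabilityMeasure P] {ξ : Ω → ℝ} (hξ : AEMeasurable ξ P) (h0 : P[ξ] = 0)
    (h1 : P[ξ ^ 2] = 1) :
    (fun t : ℝ => charFun (P.map ξ) t - Complex.exp (-(t : ℂ) ^ 2 / 2)) =o[𝓝 0]
      fun t => t ^ 2 := by
  have hg := taylor_charFun_two (P := gaussianReal 0 1) (X := id) aemeasurable_id
    (by simp) (by
      have := variance_eq_integral (μ := gaussianReal 0 1) (X := id) aemeasurable_id
      simp only [variance_id_gaussianReal, id, integral_id_gaussianReal, sub_zero] at this
      simpa using this.symm)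
  refine ((taylor_charFun_two hξ h0 h1).sub hg).congr_left fun t => ?_
  simp only [Measure.map_id, charFun_gaussianReal]
  simp [neg_div]

/-- **Central limit theorem for weighted sums** `∑_{t<n} a_{n,t} ξ_t` of an i.i.d. standardized
sequence, when the weights are uniformly negligible and their squares sum to `1` in the limit. -/
theorem tendstoInDistribution_weighted_sum {Ω : Type*} {mΩ : MeasurableSpace Ω} {P : Measure Ω}
    [IsProbabilityMeasure P] {ξ : ℕ → Ω → ℝ} (hind : iIndepFun ξ P)
    (hid : ∀ i, IdentDistrib (ξ i) (ξ 0) P P) (h0 : P[ξ 0] = 0) (h1 : P[ξ 0 ^ 2] = 1)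
    {a : ℕ → ℕ → ℝ} {m : ℕ → ℝ} (hm : Tendsto m atTop (𝓝 0))
    (ham : ∀ n, ∀ t < n, |a n t| ≤ m n)
    (ha : Tendsto (fun n => ∑ t ∈ Finset.range n, a n t ^ 2) atTop (𝓝 1)) :
    TendstoInDistribution (fun n ω => ∑ t ∈ Finset.range n, a n t * ξ t ω) atTop (id : ℝ → ℝ)
      (fun _ => P) (gaussianReal 0 1) where
  forall_aemeasurable n := Finset.aemeasurable_fun_sum _ fun i _ =>
    (hid i).aemeasurable_fst.const_mul _
  tendsto := by
    refine ProbabilityMeasure.tendsto_iff_tendsto_charFun.2 fun u => ?_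
    have mξ i : AEMeasurable (ξ i) P := (hid i).aemeasurable_fst
    simp only [ProbabilityMeasure.coe_mk, Measure.map_id]
    set φ := charFun (P.map (ξ 0)) with hφ
    have : IsProbabilityMeasure (P.map (ξ 0)) := Measure.isProbabilityMeasure_map (mξ 0)
    have hchar n : charFun (P.map fun ω => ∑ t ∈ Finset.range n, a n t * ξ t ω) u =
        (∏ t ∈ Finset.range n, φ (a n t * u) : ℂ) := by
      have hI : iIndepFun (fun t ω => a n t * ξ t ω) P :=
        hind.comp (fun t x => a n t * x) fun t => by fun_prop
      rw [(hI.restrict _).charFun_map_fun_finsetSum_eq_prod fun i _ => (mξ i).const_mul _,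
        Finset.prod_apply]
      refine Finset.prod_congr rfl fun t _ => ?_
      rw [charFun_map_mul_comp (mξ t), (hid t).map_eq]
    -- Gaussian factors multiply exactly, so their product depends on the weights only through the
    -- sum of squares.
    have hgauss n : ∏ t ∈ Finset.range n, Complex.exp (-((a n t * u : ℝ) : ℂ) ^ 2 / 2) =
        Complex.exp (-((∑ t ∈ Finset.range n, a n t ^ 2 : ℝ) : ℂ) * (u : ℂ) ^ 2 / 2) := by
      rw [← Complex.exp_sum]
      congr 1
      push_cast
      rw [← Finset.sum_neg_distrib, Finset.sum_mul, Finset.sum_div]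
      exact Finset.sum_congr rfl fun t _ => by ring
    have hlim : Tendsto (fun n => Complex.exp
        (-((∑ t ∈ Finset.range n, a n t ^ 2 : ℝ) : ℂ) * (u : ℂ) ^ 2 / 2)) atTop
        (𝓝 (charFun (gaussianReal 0 1) u)) := by
      have h2 : Tendsto (fun n => ((∑ t ∈ Finset.range n, a n t ^ 2 : ℝ) : ℂ)) atTop
          (𝓝 ((1 : ℝ) : ℂ)) := (Complex.continuous_ofReal.tendsto 1).comp ha
      have h3 := ((Complex.continuous_exp.tendsto _).comp
        (((h2.neg).mul_const ((u : ℂ) ^ 2)).div_const 2))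
      simpa [charFun_gaussianReal, Function.comp_def, neg_div] using h3
    -- Lindeberg exchange: all factors lie in the unit disc, so replacing them one at a time costs
    -- at most the sum of the individual differences, each `o((a n t * u)²)` uniformly in `t` by
    -- negligibility of the weights.
    have hdiff : Tendsto (fun n => ∏ t ∈ Finset.range n, φ (a n t * u) -
        ∏ t ∈ Finset.range n, Complex.exp (-((a n t * u : ℝ) : ℂ) ^ 2 / 2)) atTop (𝓝 0) := by
      rw [Metric.tendsto_nhds]
      intro ε hε
      -- The final bound is `2 η u²`, the sum of squares being eventually below `2`; the `+ 1`
      -- covers `u = 0`.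
      set η := ε / (2 * (u ^ 2 + 1)) with hη
      have hη0 : 0 < η := by positivity
      have hsmall := (isLittleO_charFun_sub_exp (mξ 0) h0 h1).def hη0
      obtain ⟨δ, hδ, hball⟩ := Metric.eventually_nhds_iff.1 hsmall
      have hmu : Tendsto (fun n => m n * |u|) atTop (𝓝 0) := by simpa using hm.mul_const |u|
      filter_upwards [hmu.eventually_lt_const hδ, ha.eventually_lt_const one_lt_two] with n hn hn2
      rw [dist_zero_right]
      calc _ ≤ ∑ t ∈ Finset.range n, ‖φ (a n t * u) -
              Complex.exp (-((a n t * u : ℝ) : ℂ) ^ 2 / 2)‖ := by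
            refine norm_prod_sub_prod_le_sum _ _ _ (fun t _ => norm_charFun_le_one _)
              fun t _ => ?_
            rw [Complex.norm_exp, Real.exp_le_one_iff]
            rw [show -((a n t * u : ℝ) : ℂ) ^ 2 / 2 = ((-(a n t * u) ^ 2 / 2 : ℝ) : ℂ) by
              push_cast; ring, Complex.ofReal_re]
            nlinarith [sq_nonneg (a n t * u)]
        _ ≤ ∑ t ∈ Finset.range n, η * (a n t ^ 2 * u ^ 2) := by
            refine Finset.sum_le_sum fun t ht => ?_
            have := @hball (a n t * u) (by
              rw [dist_zero_right, Real.norm_eq_abs, abs_mul]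
              exact (mul_le_mul_of_nonneg_right (ham n t (Finset.mem_range.1 ht))
                (abs_nonneg u)).trans_lt hn)
            rw [Real.norm_eq_abs, abs_of_nonneg (sq_nonneg _), mul_pow] at this
            exact this
        _ = η * u ^ 2 * ∑ t ∈ Finset.range n, a n t ^ 2 := by
            rw [Finset.mul_sum]
            exact Finset.sum_congr rfl fun t _ => by ring
        _ ≤ η * u ^ 2 * 2 := by gcongr
        _ < ε := by
            rw [hη]
            have : 0 < u ^ 2 + 1 := by positivity
            rw [div_mul_eq_mul_div, div_mul_eq_mul_div, div_lt_iff₀ (by positivity)]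
            nlinarith
    have := hdiff.add hlim
    simp_rw [hgauss, sub_add_cancel, zero_add] at this
    simpa only [hchar] using this

/-- Convergence in distribution only depends on the laws of the random variables. -/
lemma tendstoInDistribution_of_map_eq {ι Ω' E : Type*} {Ω₁ Ω₂ : ι → Type*}
    {m₁ : ∀ i, MeasurableSpace (Ω₁ i)} {m₂ : ∀ i, MeasurableSpace (Ω₂ i)}
    {P : ∀ i, Measure (Ω₁ i)} {Q : ∀ i, Measure (Ω₂ i)} [∀ i, IsProbabilityMeasure (P i)]
    [∀ i, IsProbabilityMeasure (Q i)] {m' : MeasurableSpace Ω'} {μ : Measure Ω'}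
    [IsProbabilityMeasure μ] [TopologicalSpace E] [MeasurableSpace E] [OpensMeasurableSpace E]
    {ξ : ∀ i, Ω₁ i → E} {ζ : ∀ i, Ω₂ i → E} {Z : Ω' → E} {l : Filter ι}
    (h : TendstoInDistribution ξ l Z P μ) (hζ : ∀ i, AEMeasurable (ζ i) (Q i))
    (heq : ∀ i, (Q i).map (ζ i) = (P i).map (ξ i)) : TendstoInDistribution ζ l Z Q μ where
  forall_aemeasurable := hζ
  aemeasurable_limit := h.aemeasurable_limit
  tendsto := by
    refine h.tendsto.congr fun i => Subtype.ext (heq i).symm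

/-- Convergence in probability to a constant from a first-moment bound. -/
lemma tendstoInMeasure_const_of_integral_le {Ω : Type*} {mΩ : MeasurableSpace Ω} {P : Measure Ω}
    [IsProbabilityMeasure P] {ξ g : ℕ → Ω → ℝ} {c : ℝ} {b : ℕ → ℝ}
    (hg : ∀ n, Integrable (g n) P) (hξ : ∀ᶠ n in atTop, ∀ᵐ ω ∂P, |ξ n ω - c| ≤ g n ω)
    (hb : ∀ᶠ n in atTop, ∫ ω, g n ω ∂P ≤ b n) (hlim : Tendsto b atTop (𝓝 0)) :
    TendstoInMeasure P ξ atTop fun _ => c := by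
  rw [tendstoInMeasure_iff_measureReal_norm]
  intro ε hε
  have hlim' : Tendsto (fun n => b n / ε) atTop (𝓝 0) := by simpa using hlim.div_const ε
  refine squeeze_zero' (Eventually.of_forall fun n => measureReal_nonneg) ?_ hlim'
  filter_upwards [hξ, hb] with n hn hbn
  have hpos : 0 ≤ᵐ[P] g n := by
    filter_upwards [hn] with ω hω using (abs_nonneg _).trans hω
  have hmarkov := mul_meas_ge_le_integral_of_nonneg hpos (hg n) ε
  rw [le_div_iff₀ hε, mul_comm]
  refine le_trans ?_ (hmarkov.trans hbn)
  refine mul_le_mul_of_nonneg_left ?_ hε.le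
  refine ENNReal.toReal_mono (measure_ne_top _ _) (measure_mono_ae ?_)
  filter_upwards [hn] with ω hω h
  exact le_trans h hω

/-- First-moment criterion for convergence in probability to a constant, for random variables on
varying probability spaces that are realized jointly on the product space. -/
lemma tendstoInMeasure_infinitePi_of_integral_le {Ω : Type*} {mΩ : MeasurableSpace Ω}
    {P : ℕ → Measure Ω} [∀ n, IsProbabilityMeasure (P n)] {ξ g : ℕ → Ω → ℝ} {c : ℝ} {b : ℕ → ℝ}
    (hg : ∀ n, Integrable (g n) (P n)) (hξ : ∀ n, ∀ᵐ ω ∂(P n), |ξ n ω - c| ≤ g n ω)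
    (hb : ∀ᶠ n in atTop, ∫ ω, g n ω ∂(P n) ≤ b n) (hlim : Tendsto b atTop (𝓝 0)) :
    TendstoInMeasure (Measure.infinitePi P) (fun n ω => ξ n (ω n)) atTop fun _ => c := by
  have hev n : MeasurePreserving (fun ω : ℕ → Ω => ω n) (Measure.infinitePi P) (P n) :=
    measurePreserving_eval_infinitePi P n
  refine tendstoInMeasure_const_of_integral_le (g := fun n (ω : ℕ → Ω) => g n (ω n))
    (fun n => (hev n).integrable_comp_of_integrable (hg n))
    (Eventually.of_forall fun n => (hev n).quasiMeasurePreserving.ae (hξ n)) ?_ hlim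
  filter_upwards [hb] with n hn
  rwa [← integral_map (hev n).aemeasurable (by rw [(hev n).map_eq]; exact (hg n).1),
    (hev n).map_eq]

/-- Continuous mapping for convergence in probability to a constant. -/
lemma _root_.MeasureTheory.TendstoInMeasure.comp_continuousAt_const {ι Ω : Type*}
    {mΩ : MeasurableSpace Ω} {P : Measure Ω} [IsFiniteMeasure P] {l : Filter ι} {ξ : ι → Ω → ℝ}
    {c : ℝ} {f : ℝ → ℝ} (h : TendstoInMeasure P ξ l fun _ => c) (hf : ContinuousAt f c) :
    TendstoInMeasure P (fun i ω => f (ξ i ω)) l fun _ => f c := by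
  rw [tendstoInMeasure_iff_measureReal_dist] at h ⊢
  intro ε hε
  obtain ⟨δ, hδ, hball⟩ := Metric.continuousAt_iff.1 hf ε hε
  refine squeeze_zero (fun i => measureReal_nonneg) (fun i => measureReal_mono ?_) (h δ hδ)
  intro ω hω
  by_contra hlt
  exact absurd (hball (not_le.1 hlt)) (not_lt.2 hω)

/-! ### Quantiles of the standard normal law -/

lemma cdf_gaussianReal_normalQuantile {α : ℝ} (h0 : 0 < α) (h1 : α < 1) :
    cdf (gaussianReal 0 1) (normalQuantile α) = α := by
  set F := cdf (gaussianReal 0 1) with hF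
  have hna : NullSingletonClass (gaussianReal 0 1) := nullSingletonClass_gaussianReal one_ne_zero
  have hcont : Continuous F := by
    rw [continuous_iff_continuousAt]
    intro x
    -- A jump of the distribution function would be an atom.
    rw [F.mono.continuousAt_iff_leftLim_eq_rightLim, F.rightLim_eq]
    have h := F.measure_singleton x
    rw [hF, measure_cdf, measure_singleton] at h
    have h2 := ENNReal.ofReal_eq_zero.1 h.symm
    exact le_antisymm (F.mono.leftLim_le le_rfl) (by rw [hF]; linarith)
  have hne : {x : ℝ | α ≤ F x}.Nonempty := by
    obtain ⟨x, hx⟩ := ((tendsto_cdf_atTop (gaussianReal 0 1)).eventually_const_lt h1).exists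
    exact ⟨x, hx.le⟩
  have hbdd : BddBelow {x : ℝ | α ≤ F x} := by
    obtain ⟨x, hx⟩ := ((tendsto_cdf_atBot (gaussianReal 0 1)).eventually_lt_const h0).exists
    refine ⟨x, fun y hy => ?_⟩
    by_contra hlt
    exact absurd (hy.trans (F.mono (not_le.1 hlt).le)) (not_le.2 hx)
  refine le_antisymm ?_ ?_
  -- Left of the infimum the distribution function is below `α`, and this passes to the limit;
  -- conversely the infimum belongs to the closed set defining it.
  · refine le_of_tendsto (hcont.continuousAt.tendsto.mono_left nhdsWithin_le_nhds :
      Tendsto F (𝓝[<] (normalQuantile α)) _) ?_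
    filter_upwards [self_mem_nhdsWithin] with x hx
    exact le_of_lt (not_le.1 fun hle => absurd (csInf_le hbdd hle) (not_le.2 hx))
  · exact (isClosed_le continuous_const hcont).csInf_mem hne hbdd

lemma gaussianReal_Iio_normalQuantile {α : ℝ} (h0 : 0 < α) (h1 : α < 1) :
    (gaussianReal 0 1).real (Set.Iio (normalQuantile α)) = α := by
  have hna : NullSingletonClass (gaussianReal 0 1) := nullSingletonClass_gaussianReal one_ne_zero
  rw [measureReal_congr Iio_ae_eq_Iic, ← cdf_eq_real, cdf_gaussianReal_normalQuantile h0 h1]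

end INAR

namespace INAR

/-! ### The innovations -/

/-- Centred innovation `ε_{t+1} - μ_G`. -/
noncomputable def centredInnov (G : Measure ℕ) (t : ℕ) (e : ℕ → ℕ) : ℝ := (e t : ℝ) - innovMean G

/-- Cumulated innovations `∑_{s ≤ t} ε_s`, that is, the process without thinning. -/
def cumInnov (t : ℕ) (e : ℕ → ℕ) : ℕ := ∑ s ∈ Finset.range t, e s

/-- Centred random walk `∑_{s ≤ t} (ε_s - μ_G)`. -/
noncomputable def centredWalk (G : Measure ℕ) (t : ℕ) (e : ℕ → ℕ) : ℝ :=
  ∑ s ∈ Finset.range t, centredInnov G s e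

lemma cumInnov_eq (G : Measure ℕ) (t : ℕ) (e : ℕ → ℕ) :
    (cumInnov t e : ℝ) = centredWalk G t e + t * innovMean G := by
  simp [cumInnov, centredWalk, centredInnov, Finset.sum_sub_distrib]

lemma cumInnov_mono (e : ℕ → ℕ) : Monotone fun t => cumInnov t e := fun _ _ h =>
  Finset.sum_le_sum_of_subset (Finset.range_mono h)

@[fun_prop]
lemma measurable_cumInnov (t : ℕ) : Measurable (cumInnov t) := by
  unfold cumInnov; fun_prop

@[fun_prop]
lemma measurable_centredInnov (G : Measure ℕ) (t : ℕ) : Measurable (centredInnov G t) := by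
  unfold centredInnov; fun_prop

@[fun_prop]
lemma measurable_centredWalk (G : Measure ℕ) (t : ℕ) : Measurable (centredWalk G t) := by
  unfold centredWalk; fun_prop

lemma memLp_two_of_integrable_pow_three {G : Measure ℕ}
    (hG3 : Integrable (fun k : ℕ => (k : ℝ) ^ 3) G) : MemLp (fun k : ℕ => (k : ℝ)) 2 G := by
  rw [memLp_two_iff_integrable_sq (by fun_prop)]
  refine hG3.mono' (by fun_prop) (ae_of_all _ fun k => ?_)
  rw [Real.norm_of_nonneg (by positivity)]
  have : k ^ 2 ≤ k ^ 3 := by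
    rcases Nat.eq_zero_or_pos k with rfl | hk
    · simp
    · exact Nat.pow_le_pow_right hk (by norm_num)
  exact_mod_cast this

lemma integral_comp_of_measurePreserving {α β : Type*} {mα : MeasurableSpace α}
    {mβ : MeasurableSpace β} {μ : Measure α} {ν : Measure β} {f : α → β}
    (hf : MeasurePreserving f μ ν) {g : β → ℝ} (hg : Measurable g) :
    ∫ a, g (f a) ∂μ = ∫ b, g b ∂ν := by
  rw [← hf.map_eq, integral_map hf.aemeasurable hg.aestronglyMeasurable]

section Innovations

variable {G : Measure ℕ} [IsProbabilityMeasure G]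

/-- A nonnegative variable of mean zero vanishes almost surely and has no variance. The positive
drift is what makes the linear trend dominate. -/
lemma innovMean_pos (hvar : 0 < innovVar G) : 0 < innovMean G := by
  refine lt_of_le_of_ne (integral_nonneg fun k => by positivity) fun h => ?_
  -- The variance takes the default value `0` outside `L²`, so a positive one implies square
  -- integrability.
  have hL2 : MemLp (fun k : ℕ => (k : ℝ)) 2 G :=
    memLp_two_of_variance_ne_zero (by fun_prop) hvar.ne'
  have hint : Integrable (fun k : ℕ => (k : ℝ)) G := hL2.integrable one_le_two
  have h0 : (fun k : ℕ => (k : ℝ)) =ᵐ[G] 0 :=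
    (integral_eq_zero_iff_of_nonneg (fun k => by positivity) hint).1 h.symm
  refine hvar.ne' ?_
  rw [innovVar, variance_congr h0]
  exact variance_zero _

lemma measurePreserving_innov (t : ℕ) :
    MeasurePreserving (fun e : ℕ → ℕ => e t) (Measure.infinitePi fun _ => G) G :=
  measurePreserving_eval_infinitePi (fun _ => G) t

lemma memLp_centredInnov (hL2 : MemLp (fun k : ℕ => (k : ℝ)) 2 G) (t : ℕ) :
    MemLp (centredInnov G t) 2 (Measure.infinitePi fun _ => G) :=
  (hL2.comp_measurePreserving (measurePreserving_innov t)).sub (memLp_const _)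

lemma memLp_centredWalk (hL2 : MemLp (fun k : ℕ => (k : ℝ)) 2 G) (t : ℕ) :
    MemLp (centredWalk G t) 2 (Measure.infinitePi fun _ => G) :=
  memLp_finsetSum _ fun s _ => memLp_centredInnov hL2 s

lemma memLp_cumInnov (hL2 : MemLp (fun k : ℕ => (k : ℝ)) 2 G) (t : ℕ) :
    MemLp (fun e => (cumInnov t e : ℝ)) 2 (Measure.infinitePi fun _ => G) := by
  simp_rw [cumInnov_eq G]
  exact (memLp_centredWalk hL2 t).add (memLp_const _)

lemma integral_centredInnov (hL2 : MemLp (fun k : ℕ => (k : ℝ)) 2 G) (t : ℕ) :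
    ∫ e, centredInnov G t e ∂(Measure.infinitePi fun _ => G) = 0 := by
  have hint := hL2.integrable one_le_two
  have h := integral_comp_of_measurePreserving (measurePreserving_innov (G := G) t)
    (g := fun k : ℕ => (k : ℝ) - innovMean G) (by fun_prop)
  simp only [centredInnov]
  rw [h, integral_sub hint (integrable_const _)]
  simp [innovMean]

lemma integral_centredInnov_sq (t : ℕ) :
    ∫ e, centredInnov G t e ^ 2 ∂(Measure.infinitePi fun _ => G) = innovVar G := by
  have h := integral_comp_of_measurePreserving (measurePreserving_innov (G := G) t)
    (g := fun k : ℕ => ((k : ℝ) - innovMean G) ^ 2) (by fun_prop)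
  simp only [centredInnov]
  rw [h, innovVar, variance_eq_integral (by fun_prop)]
  rfl

lemma iIndepFun_centredInnov :
    iIndepFun (centredInnov G) (Measure.infinitePi fun _ => G) :=
  iIndepFun_infinitePi (P := fun _ : ℕ => G) (X := fun _ k => (k : ℝ) - innovMean G)
    fun _ => by fun_prop

lemma identDistrib_centredInnov (t : ℕ) :
    IdentDistrib (centredInnov G t) (centredInnov G 0) (Measure.infinitePi fun _ => G)
      (Measure.infinitePi fun _ => G) := by
  have h : IdentDistrib (fun e : ℕ → ℕ => e t) (fun e : ℕ → ℕ => e 0)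
      (Measure.infinitePi fun _ => G) (Measure.infinitePi fun _ => G) :=
    ⟨(measurable_pi_apply t).aemeasurable, (measurable_pi_apply 0).aemeasurable,
      (measurePreserving_innov t).map_eq.trans (measurePreserving_innov 0).map_eq.symm⟩
  exact h.comp (u := fun k : ℕ => (k : ℝ) - innovMean G) (by fun_prop)

lemma integral_centredWalk_sq (hL2 : MemLp (fun k : ℕ => (k : ℝ)) 2 G) (t : ℕ) :
    ∫ e, centredWalk G t e ^ 2 ∂(Measure.infinitePi fun _ => G) = t * innovVar G := by
  have h0 : ∫ e, centredWalk G t e ∂(Measure.infinitePi fun _ => G) = 0 := by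
    simp only [centredWalk]
    rw [integral_finsetSum _ fun s _ => (memLp_centredInnov hL2 s).integrable one_le_two]
    simp [integral_centredInnov hL2]
  have h1 := variance_of_integral_eq_zero (memLp_centredWalk hL2 t).aemeasurable h0
  rw [← h1]
  have h2 := IndepFun.variance_sum (μ := Measure.infinitePi fun _ => G) (X := centredInnov G)
    (s := Finset.range t) (fun s _ => memLp_centredInnov hL2 s)
    fun i _ j _ hij => iIndepFun_centredInnov.indepFun hij
  have h3 : centredWalk G t = ∑ s ∈ Finset.range t, centredInnov G s := by
    ext e; simp [centredWalk]
  rw [h3, h2]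
  have h4 s : Var[centredInnov G s; Measure.infinitePi fun _ => G] = innovVar G := by
    rw [variance_of_integral_eq_zero (memLp_centredInnov hL2 s).aemeasurable
      (integral_centredInnov hL2 s), integral_centredInnov_sq]
  simp [h4]

lemma integral_cumInnov_sq_le (hL2 : MemLp (fun k : ℕ => (k : ℝ)) 2 G) (t : ℕ) :
    ∫ e, (cumInnov t e : ℝ) ^ 2 ∂(Measure.infinitePi fun _ => G) ≤
      2 * (t * innovVar G + (t * innovMean G) ^ 2) := by
  have hW := (memLp_centredWalk hL2 t).integrable_sq
  calc _ ≤ ∫ e, 2 * (centredWalk G t e ^ 2 + (t * innovMean G) ^ 2)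
          ∂(Measure.infinitePi fun _ => G) := by
        refine integral_mono (memLp_cumInnov hL2 t).integrable_sq
          ((hW.add (integrable_const _)).const_mul 2) fun e => ?_
        simp only [cumInnov_eq G]
        nlinarith [sq_nonneg (centredWalk G t e - t * innovMean G)]
    _ = _ := by
        rw [integral_const_mul, integral_add hW (integrable_const _),
          integral_centredWalk_sq hL2]
        simp

end Innovations

/-! ### The thinned individuals -/

/-- Number of failures among the first `cumInnov s` thinning variables at time `s + 1`; it
dominates the number of individuals lost by the process at that time. -/
def lossBound (s : ℕ) (ω : Space) : ℝ :=
  ∑ j ∈ Finset.range (cumInnov s ω.1), (1 - (ω.2 (j, s) : ℝ))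

/-- The number of summands is random but has countably many values, so measurability can be checked
with it frozen. -/
lemma measurable_sum_range_of_measurable {α M : Type*} [MeasurableSpace α] [AddCommMonoid M]
    [MeasurableSpace M] [MeasurableAdd₂ M] {N : α → ℕ} {f : ℕ → α → M} (hN : Measurable N)
    (hf : ∀ j, Measurable (f j)) : Measurable fun a => ∑ j ∈ Finset.range (N a), f j a := by
  have h : Measurable fun p : ℕ × α => ∑ j ∈ Finset.range p.1, f j p.2 :=
    measurable_from_prod_countable_right fun k => by
      simpa using Finset.measurable_fun_sum _ fun j _ => hf j
  exact h.comp (hN.prodMk measurable_id)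

@[fun_prop]
lemma measurable_lossBound (s : ℕ) : Measurable (lossBound s) :=
  measurable_sum_range_of_measurable (by fun_prop) fun j => by fun_prop

@[fun_prop]
lemma measurable_X (t : ℕ) : Measurable (X t) := by
  induction t with
  | zero => exact measurable_const
  | succ t ih =>
    exact (measurable_sum_range_of_measurable ih fun j => by fun_prop).add (by fun_prop)

section Thinning

variable {θ : unitInterval} {G : Measure ℕ} [IsProbabilityMeasure G]

/-- The sample space allows any natural value for the thinning variables; the pathwise comparisons
below need this event of full measure. -/
lemma ae_thinning_le_one :
    ∀ᵐ z ∂(Measure.infinitePi fun _ : ℕ × ℕ => bernoulliMeasure (1 : ℕ) 0 θ),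
      ∀ p, z p ≤ 1 := by
  rw [ae_all_iff]
  intro p
  have h : ∀ᵐ k ∂(bernoulliMeasure (1 : ℕ) 0 θ), k ≤ 1 := by
    rw [bernoulliMeasure_def, ae_add_measure_iff]
    constructor
    · exact Measure.ae_smul_measure (by rw [ae_dirac_iff (by measurability)]) _
    · exact Measure.ae_smul_measure (by rw [ae_dirac_iff (by measurability)]; simp) _
  exact (measurePreserving_eval_infinitePi (fun _ : ℕ × ℕ => bernoulliMeasure (1 : ℕ) 0 θ)
    p).quasiMeasurePreserving.ae h

lemma ae_law_thinning_le_one : ∀ᵐ ω ∂(law θ G), ∀ p, ω.2 p ≤ 1 :=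
  Measure.quasiMeasurePreserving_snd.ae ae_thinning_le_one

lemma integrable_thinning (p : ℕ × ℕ) : Integrable (fun z : ℕ × ℕ → ℕ => 1 - (z p : ℝ))
    (Measure.infinitePi fun _ : ℕ × ℕ => bernoulliMeasure (1 : ℕ) 0 θ) :=
  (measurePreserving_eval_infinitePi (fun _ : ℕ × ℕ => bernoulliMeasure (1 : ℕ) 0 θ)
    p).integrable_comp_of_integrable (g := fun k : ℕ => 1 - (k : ℝ))
    (integrable_bernoulliMeasure _ _ _ _)

lemma integral_thinning (p : ℕ × ℕ) : ∫ z : ℕ × ℕ → ℕ, (1 - (z p : ℝ))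
    ∂(Measure.infinitePi fun _ : ℕ × ℕ => bernoulliMeasure (1 : ℕ) 0 θ) = 1 - θ := by
  have h := integral_comp_of_measurePreserving (measurePreserving_eval_infinitePi
    (fun _ : ℕ × ℕ => bernoulliMeasure (1 : ℕ) 0 θ) p) (g := fun k : ℕ => 1 - (k : ℝ)) (by fun_prop)
  simp only [Function.eval] at h
  rw [h, integral_bernoulliMeasure]
  simp

lemma lossBound_nonneg {ω : Space} (hω : ∀ p, ω.2 p ≤ 1) (s : ℕ) : 0 ≤ lossBound s ω :=
  Finset.sum_nonneg fun j _ => sub_nonneg.2 (by exact_mod_cast hω (j, s))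

lemma lossBound_le {ω : Space} (s : ℕ) : lossBound s ω ≤ cumInnov s ω.1 := by
  calc lossBound s ω ≤ ∑ j ∈ Finset.range (cumInnov s ω.1), (1 : ℝ) :=
        Finset.sum_le_sum fun j _ => by simp
    _ = _ := by simp

lemma integrable_mul_lossBound {F : (ℕ → ℕ) → ℝ} (hF : Measurable F) {s : ℕ}
    (hFY : Integrable (fun e => F e * cumInnov s e) (Measure.infinitePi fun _ => G)) :
    Integrable (fun ω : Space => F ω.1 * lossBound s ω) (law θ G) := by
  have h1 : Integrable (fun ω : Space => F ω.1 * cumInnov s ω.1) (law θ G) := hFY.comp_fst _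
  refine h1.mono (by fun_prop) ?_
  filter_upwards [ae_law_thinning_le_one] with ω hω
  rw [norm_mul, norm_mul, Real.norm_of_nonneg (lossBound_nonneg hω s),
    Real.norm_of_nonneg (Nat.cast_nonneg _)]
  exact mul_le_mul_of_nonneg_left (lossBound_le s) (norm_nonneg _)

/-- Fubini: given the innovations, the number of trials in `lossBound` is fixed and each fails with
probability `1 - θ`. This is the reason for counting failures among `cumInnov s` individuals instead
of `X s`, which depends on earlier thinning. -/
lemma integral_mul_lossBound {F : (ℕ → ℕ) → ℝ} (hF : Measurable F) {s : ℕ}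
    (hFY : Integrable (fun e => F e * cumInnov s e) (Measure.infinitePi fun _ => G)) :
    ∫ ω : Space, F ω.1 * lossBound s ω ∂(law θ G) =
      (1 - θ) * ∫ e, F e * cumInnov s e ∂(Measure.infinitePi fun _ => G) := by
  have h := integrable_mul_lossBound (θ := θ) hF hFY
  rw [law] at h ⊢
  rw [integral_prod _ h, ← integral_const_mul]
  refine integral_congr_ae (ae_of_all _ fun e => ?_)
  simp only [lossBound]
  rw [integral_const_mul, integral_finsetSum _ fun j _ => integrable_thinning (j, s)]
  simp only [integral_thinning]
  simp
  ring

/-! ### Pathwise comparison with the process without thinning -/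

lemma X_le_cumInnov {ω : Space} (hω : ∀ p, ω.2 p ≤ 1) (t : ℕ) : X t ω ≤ cumInnov t ω.1 := by
  induction t with
  | zero => simp [X, cumInnov]
  | succ t ih =>
    rw [X, cumInnov, Finset.sum_range_succ]
    gcongr
    calc ∑ j ∈ Finset.range (X t ω), ω.2 (j, t) ≤ ∑ j ∈ Finset.range (X t ω), 1 :=
          Finset.sum_le_sum fun j _ => hω _
      _ ≤ _ := by simpa [cumInnov] using ih

lemma loss_le_lossBound {ω : Space} (hω : ∀ p, ω.2 p ≤ 1) (t : ℕ) :
    (X t ω : ℝ) - ∑ j ∈ Finset.range (X t ω), (ω.2 (j, t) : ℝ) ≤ lossBound t ω := by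
  calc (X t ω : ℝ) - ∑ j ∈ Finset.range (X t ω), (ω.2 (j, t) : ℝ)
      = ∑ j ∈ Finset.range (X t ω), (1 - (ω.2 (j, t) : ℝ)) := by simp [Finset.sum_sub_distrib]
    _ ≤ lossBound t ω :=
      Finset.sum_le_sum_of_subset_of_nonneg (Finset.range_mono (X_le_cumInnov hω t))
        fun j _ _ => sub_nonneg.2 (by exact_mod_cast hω (j, t))

lemma loss_nonneg {ω : Space} (hω : ∀ p, ω.2 p ≤ 1) (t : ℕ) :
    0 ≤ (X t ω : ℝ) - ∑ j ∈ Finset.range (X t ω), (ω.2 (j, t) : ℝ) := by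
  calc (0 : ℝ) ≤ ∑ j ∈ Finset.range (X t ω), (1 - (ω.2 (j, t) : ℝ)) :=
        Finset.sum_nonneg fun j _ => sub_nonneg.2 (by exact_mod_cast hω (j, t))
    _ = _ := by simp [Finset.sum_sub_distrib]

/-- Both processes receive the same innovations, so the gap grows only by the individuals lost at
each step. -/
lemma cumInnov_sub_X_le {ω : Space} (hω : ∀ p, ω.2 p ≤ 1) (t : ℕ) :
    (cumInnov t ω.1 : ℝ) - X t ω ≤ ∑ s ∈ Finset.range t, lossBound s ω := by
  induction t with
  | zero => simp [X, cumInnov]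
  | succ t ih =>
    have h := loss_le_lossBound hω t
    rw [Finset.sum_range_succ, X, cumInnov, Finset.sum_range_succ, ← cumInnov]
    push_cast
    linarith

/-- Numerator of `θ̂_n - 1`. -/
noncomputable def olsNumerator (G : Measure ℕ) (n : ℕ) (ω : Space) : ℝ :=
  ∑ t ∈ Finset.range n, (X t ω : ℝ) * ((X (t + 1) ω : ℝ) - innovMean G - X t ω)

/-- Bound for the distance between `olsNumerator` and its leading term. -/
noncomputable def numeratorErr (G : Measure ℕ) (n : ℕ) (ω : Space) : ℝ :=
  (centredWalk G n ω.1 ^ 2 + ∑ t ∈ Finset.range n, centredInnov G t ω.1 ^ 2) / 2 +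
    ∑ t ∈ Finset.range n, ∑ s ∈ Finset.range t, |centredInnov G t ω.1| * lossBound s ω +
    ∑ t ∈ Finset.range n, (cumInnov t ω.1 : ℝ) * lossBound t ω

/-- Discrete Itô formula, from telescoping the squares of the walk. It bounds the stochastic
integral by quantities of mean `n σ²`. -/
lemma sum_centredWalk_mul_centredInnov (G : Measure ℕ) (n : ℕ) (e : ℕ → ℕ) :
    ∑ t ∈ Finset.range n, centredWalk G t e * centredInnov G t e =
      (centredWalk G n e ^ 2 - ∑ t ∈ Finset.range n, centredInnov G t e ^ 2) / 2 := by
  induction n with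
  | zero => simp [centredWalk]
  | succ n ih =>
    have h : centredWalk G (n + 1) e = centredWalk G n e + centredInnov G n e := by
      simp [centredWalk, Finset.sum_range_succ]
    rw [Finset.sum_range_succ, Finset.sum_range_succ, ih, h]
    ring

/-- Substitute `X_t = μ t + W_t - gap` and `X_{t+1} - μ - X_t = innovation - loss`, where `W` is the
centred walk. Besides the leading term there remain the stochastic integral of `W`, the gap times
the innovation, and `X_t` times the loss. -/
lemma abs_olsNumerator_sub_le (G : Measure ℕ) {ω : Space} (hω : ∀ p, ω.2 p ≤ 1) (n : ℕ) :
    |olsNumerator G n ω - innovMean G * ∑ t ∈ Finset.range n, (t : ℝ) * centredInnov G t ω.1| ≤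
      numeratorErr G n ω := by
  have hdecomp : olsNumerator G n ω -
      innovMean G * ∑ t ∈ Finset.range n, (t : ℝ) * centredInnov G t ω.1 =
      ∑ t ∈ Finset.range n, centredWalk G t ω.1 * centredInnov G t ω.1 -
      ∑ t ∈ Finset.range n, ((cumInnov t ω.1 : ℝ) - X t ω) * centredInnov G t ω.1 -
      ∑ t ∈ Finset.range n, (X t ω : ℝ) *
        ((X t ω : ℝ) - ∑ j ∈ Finset.range (X t ω), (ω.2 (j, t) : ℝ)) := by
    rw [olsNumerator, Finset.mul_sum, ← Finset.sum_sub_distrib, ← Finset.sum_sub_distrib,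
      ← Finset.sum_sub_distrib]
    refine Finset.sum_congr rfl fun t _ => ?_
    rw [cumInnov_eq G]
    simp only [X, centredInnov]
    push_cast
    ring
  rw [hdecomp, sum_centredWalk_mul_centredInnov, numeratorErr]
  refine (abs_sub _ _).trans (add_le_add ((abs_sub _ _).trans (add_le_add ?_ ?_)) ?_)
  · have h1 := sq_nonneg (centredWalk G n ω.1)
    have h2 : 0 ≤ ∑ t ∈ Finset.range n, centredInnov G t ω.1 ^ 2 :=
      Finset.sum_nonneg fun _ _ => sq_nonneg _
    rw [abs_le]
    constructor <;> linarith
  · refine (Finset.abs_sum_le_sum_abs _ _).trans (Finset.sum_le_sum fun t _ => ?_)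
    rw [abs_mul, abs_of_nonneg (sub_nonneg.2 (by exact_mod_cast X_le_cumInnov hω t)), mul_comm,
      ← Finset.mul_sum]
    exact mul_le_mul_of_nonneg_left (cumInnov_sub_X_le hω t) (abs_nonneg _)
  · refine (Finset.abs_sum_le_sum_abs _ _).trans (Finset.sum_le_sum fun t _ => ?_)
    rw [abs_mul, abs_of_nonneg (loss_nonneg hω t), abs_of_nonneg (Nat.cast_nonneg _)]
    exact mul_le_mul (by exact_mod_cast X_le_cumInnov hω t) (loss_le_lossBound hω t)
      (loss_nonneg hω t) (Nat.cast_nonneg _)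

/-- Bound for the distance between `∑ X_t²` and its leading term. -/
noncomputable def denominatorErr (G : Measure ℕ) (n : ℕ) (ω : Space) : ℝ :=
  ∑ t ∈ Finset.range n, ((1 + √n) * centredWalk G t ω.1 ^ 2 + (t * innovMean G) ^ 2 / √n) +
    2 * ∑ t ∈ Finset.range n, ∑ s ∈ Finset.range t, (cumInnov t ω.1 : ℝ) * lossBound s ω

/-- Two comparisons through `Y = cumInnov t`: `Y² - X² ≤ 2 Y (Y - X)` since `X ≤ Y`, and `Y` is the
trend plus the centred walk. -/
lemma abs_sum_X_sq_sub_le (G : Measure ℕ) {ω : Space} (hω : ∀ p, ω.2 p ≤ 1) (n : ℕ) :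
    |∑ t ∈ Finset.range n, (X t ω : ℝ) ^ 2 -
      innovMean G ^ 2 * ∑ t ∈ Finset.range n, (t : ℝ) ^ 2| ≤ denominatorErr G n ω := by
  rw [denominatorErr, Finset.mul_sum, ← Finset.sum_sub_distrib, Finset.mul_sum,
    ← Finset.sum_add_distrib]
  refine (Finset.abs_sum_le_sum_abs _ _).trans (Finset.sum_le_sum fun t ht => ?_)
  have hn : 0 < √(n : ℝ) := by
    have := Finset.mem_range.1 ht
    exact Real.sqrt_pos.2 (by exact_mod_cast (Nat.zero_le t).trans_lt this)
  have hXY : (X t ω : ℝ) ≤ cumInnov t ω.1 := by exact_mod_cast X_le_cumInnov hω t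
  have hD := cumInnov_sub_X_le hω t
  have hX0 : (0 : ℝ) ≤ X t ω := Nat.cast_nonneg _
  have h1 : |(X t ω : ℝ) ^ 2 - (cumInnov t ω.1 : ℝ) ^ 2| ≤
      2 * ∑ s ∈ Finset.range t, (cumInnov t ω.1 : ℝ) * lossBound s ω := by
    rw [abs_sub_comm, abs_of_nonneg (by nlinarith), ← Finset.mul_sum]
    nlinarith [mul_le_mul_of_nonneg_left hD (hX0.trans hXY)]
  have h2 : |(cumInnov t ω.1 : ℝ) ^ 2 - innovMean G ^ 2 * (t : ℝ) ^ 2| ≤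
      (1 + √n) * centredWalk G t ω.1 ^ 2 + (t * innovMean G) ^ 2 / √n := by
    rw [cumInnov_eq G]
    set w := centredWalk G t ω.1
    set m := (t : ℝ) * innovMean G
    -- Young's inequality. As `w²` has mean of order at most `n` and `m` is of order at most `n`,
    -- the weight `√n` balances the two terms at `n^{3/2}`, hence `n^{5/2}` after summation.
    have h3 : |2 * w * m| ≤ √n * w ^ 2 + m ^ 2 / √n := by
      have h4 : √(n : ℝ) * w ^ 2 + m ^ 2 / √n - 2 * w * m = (√n * w - m) ^ 2 / √n := by
        field_simp; ring
      have h5 : √(n : ℝ) * w ^ 2 + m ^ 2 / √n + 2 * w * m = (√n * w + m) ^ 2 / √n := by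
        field_simp; ring
      have h6 : 0 ≤ (√(n : ℝ) * w - m) ^ 2 / √n := by positivity
      have h7 : 0 ≤ (√(n : ℝ) * w + m) ^ 2 / √n := by positivity
      rw [abs_le]
      constructor <;> linarith
    calc |(w + m) ^ 2 - innovMean G ^ 2 * (t : ℝ) ^ 2| = |w ^ 2 + 2 * w * m| := by
          congr 1; simp only [m]; ring
      _ ≤ w ^ 2 + |2 * w * m| := (abs_add_le _ _).trans (by rw [abs_of_nonneg (sq_nonneg w)])
      _ ≤ _ := by linarith
  calc _ ≤ _ := abs_sub_le _ ((cumInnov t ω.1 : ℝ) ^ 2) _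
    _ ≤ _ := by linarith

/-! ### First-moment bounds for the error terms -/

lemma integrable_cumInnov_mul (hL2 : MemLp (fun k : ℕ => (k : ℝ)) 2 G) (s t : ℕ) :
    Integrable (fun e => (cumInnov t e : ℝ) * cumInnov s e) (Measure.infinitePi fun _ => G) :=
  (memLp_cumInnov hL2 t).integrable_mul (memLp_cumInnov hL2 s)

lemma integrable_abs_centredInnov_mul (hL2 : MemLp (fun k : ℕ => (k : ℝ)) 2 G) (s t : ℕ) :
    Integrable (fun e => |centredInnov G t e| * cumInnov s e) (Measure.infinitePi fun _ => G) :=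
  (memLp_centredInnov hL2 t).abs.integrable_mul (memLp_cumInnov hL2 s)

/-- Bound for the second moments of the cumulated innovations up to time `n`. -/
noncomputable def secondMomentBound (G : Measure ℕ) (n : ℕ) : ℝ :=
  2 * (n * innovVar G + (n * innovMean G) ^ 2)

lemma integral_cumInnov_mul_le (hL2 : MemLp (fun k : ℕ => (k : ℝ)) 2 G) {s t n : ℕ}
    (hs : s ≤ n) (ht : t ≤ n) :
    ∫ e, (cumInnov t e : ℝ) * cumInnov s e ∂(Measure.infinitePi fun _ => G) ≤
      secondMomentBound G n := by
  refine le_trans ?_ (integral_cumInnov_sq_le hL2 n)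
  refine integral_mono (integrable_cumInnov_mul hL2 s t) (memLp_cumInnov hL2 n).integrable_sq
    fun e => ?_
  rw [sq]
  have h1 : (cumInnov t e : ℝ) ≤ cumInnov n e := by exact_mod_cast cumInnov_mono e ht
  have h2 : (cumInnov s e : ℝ) ≤ cumInnov n e := by exact_mod_cast cumInnov_mono e hs
  exact mul_le_mul h1 h2 (by positivity) (by positivity)

/-- Young's inequality with weight `n`, matching an innovation of order `1` with a cumulated sum of
order `n`; both terms are then `O(n)`. -/
lemma integral_abs_centredInnov_mul_le (hL2 : MemLp (fun k : ℕ => (k : ℝ)) 2 G) {s n : ℕ}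
    (hs : s < n) (t : ℕ) :
    ∫ e, |centredInnov G t e| * cumInnov s e ∂(Measure.infinitePi fun _ => G) ≤
      n * innovVar G + secondMomentBound G n / n := by
  have hn : (0 : ℝ) < n := by exact_mod_cast (Nat.zero_le s).trans_lt hs
  have hY := (memLp_cumInnov hL2 n).integrable_sq
  have he := (memLp_centredInnov hL2 t).integrable_sq
  calc _ ≤ ∫ e, (n * centredInnov G t e ^ 2 + (cumInnov n e : ℝ) ^ 2 / n)
          ∂(Measure.infinitePi fun _ => G) := by
        refine integral_mono (integrable_abs_centredInnov_mul hL2 s t)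
          ((he.const_mul _).add (hY.div_const _)) fun e => ?_
        have h2 : (cumInnov s e : ℝ) ≤ cumInnov n e := by exact_mod_cast cumInnov_mono e hs.le
        simp only
        set y : ℝ := (cumInnov n e : ℝ)
        set x := |centredInnov G t e| with hx
        have hx0 : 0 ≤ x := abs_nonneg _
        have h3 : n * x ^ 2 + y ^ 2 / n - x * y = ((n * x - y / 2) ^ 2 + 3 / 4 * y ^ 2) / n := by
          field_simp; ring
        have h4 : 0 ≤ ((n * x - y / 2) ^ 2 + 3 / 4 * y ^ 2) / n := by positivity
        rw [← sq_abs (centredInnov G t e), ← hx]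
        nlinarith [mul_le_mul_of_nonneg_left h2 hx0]
    _ ≤ _ := by
        rw [integral_add (he.const_mul _) (hY.div_const _), integral_const_mul,
          integral_centredInnov_sq, integral_div]
        gcongr
        exact integral_cumInnov_sq_le hL2 n

lemma integrable_numeratorErr (hL2 : MemLp (fun k : ℕ => (k : ℝ)) 2 G) (n : ℕ) :
    Integrable (numeratorErr G n) (law θ G) := by
  refine ((Integrable.div_const (Integrable.add ?_ ?_) 2).add ?_).add ?_
  · exact (memLp_centredWalk hL2 n).integrable_sq.comp_fst _
  · exact integrable_finsetSum _ fun t _ => (memLp_centredInnov hL2 t).integrable_sq.comp_fst _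
  · exact integrable_finsetSum _ fun t _ => integrable_finsetSum _ fun s _ =>
      integrable_mul_lossBound (by fun_prop) (integrable_abs_centredInnov_mul hL2 s t)
  · exact integrable_finsetSum _ fun t _ =>
      integrable_mul_lossBound (F := fun e => (cumInnov t e : ℝ)) (by fun_prop)
        (integrable_cumInnov_mul hL2 t t)

lemma integrable_denominatorErr (hL2 : MemLp (fun k : ℕ => (k : ℝ)) 2 G) (n : ℕ) :
    Integrable (denominatorErr G n) (law θ G) := by
  refine Integrable.add ?_ (Integrable.const_mul ?_ 2)
  · exact integrable_finsetSum _ fun t _ =>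
      ((((memLp_centredWalk hL2 t).integrable_sq).const_mul _).add (integrable_const _)).comp_fst _
  · exact integrable_finsetSum _ fun t _ => integrable_finsetSum _ fun s _ =>
      integrable_mul_lossBound (F := fun e => (cumInnov t e : ℝ)) (by fun_prop)
        (integrable_cumInnov_mul hL2 s t)

lemma integral_law_comp_fst {F : (ℕ → ℕ) → ℝ} :
    ∫ ω : Space, F ω.1 ∂(law θ G) = ∫ e, F e ∂(Measure.infinitePi fun _ => G) := by
  rw [law, integral_fun_fst]
  simp

lemma sum_range_sum_range_le {n : ℕ} {f : ℕ → ℕ → ℝ} {b : ℝ} (hb : 0 ≤ b)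
    (h : ∀ t < n, ∀ s < t, f t s ≤ b) :
    ∑ t ∈ Finset.range n, ∑ s ∈ Finset.range t, f t s ≤ n ^ 2 * b := by
  calc _ ≤ ∑ t ∈ Finset.range n, (n * b) := by
        refine Finset.sum_le_sum fun t ht => ?_
        have ht' := Finset.mem_range.1 ht
        calc _ ≤ ∑ s ∈ Finset.range t, b :=
              Finset.sum_le_sum fun s hs => h t ht' s (Finset.mem_range.1 hs)
          _ = t * b := by simp
          _ ≤ n * b := by
            have : (t : ℝ) ≤ n := by exact_mod_cast ht'.le
            gcongr
    _ = n ^ 2 * b := by simp; ring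

lemma innovVar_nonneg (G : Measure ℕ) : 0 ≤ innovVar G := variance_nonneg _ _

lemma secondMomentBound_nonneg (G : Measure ℕ) (n : ℕ) : 0 ≤ secondMomentBound G n := by
  have := innovVar_nonneg G
  unfold secondMomentBound
  positivity

lemma integral_numeratorErr_le (hL2 : MemLp (fun k : ℕ => (k : ℝ)) 2 G) (n : ℕ) :
    ∫ ω, numeratorErr G n ω ∂(law θ G) ≤
      n * innovVar G + n ^ 2 * ((1 - θ) * (n * innovVar G + secondMomentBound G n / n)) +
        n * ((1 - θ) * secondMomentBound G n) := by
  have hq : 0 ≤ 1 - (θ : ℝ) := sub_nonneg.2 θ.2.2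
  have hV := innovVar_nonneg G
  have hM := secondMomentBound_nonneg G n
  have i1 : Integrable (fun ω : Space => centredWalk G n ω.1 ^ 2) (law θ G) :=
    (memLp_centredWalk hL2 n).integrable_sq.comp_fst _
  have i2 (t : ℕ) : Integrable (fun ω : Space => centredInnov G t ω.1 ^ 2) (law θ G) :=
    (memLp_centredInnov hL2 t).integrable_sq.comp_fst _
  have i3 (t s : ℕ) : Integrable (fun ω : Space => |centredInnov G t ω.1| * lossBound s ω)
      (law θ G) :=
    integrable_mul_lossBound (F := fun e => |centredInnov G t e|) (by fun_prop)
      (integrable_abs_centredInnov_mul hL2 s t)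
  have i4 (t : ℕ) : Integrable (fun ω : Space => (cumInnov t ω.1 : ℝ) * lossBound t ω)
      (law θ G) :=
    integrable_mul_lossBound (F := fun e => (cumInnov t e : ℝ)) (by fun_prop)
      (integrable_cumInnov_mul hL2 t t)
  have j2 := integrable_finsetSum (Finset.range n) fun t _ => i2 t
  have j3 := integrable_finsetSum (Finset.range n) fun t _ =>
    integrable_finsetSum (Finset.range t) fun s _ => i3 t s
  have j4 := integrable_finsetSum (Finset.range n) fun t _ => i4 t
  have k1 : Integrable (fun ω : Space => (centredWalk G n ω.1 ^ 2 +
      ∑ t ∈ Finset.range n, centredInnov G t ω.1 ^ 2) / 2) (law θ G) := (i1.add j2).div_const 2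
  unfold numeratorErr
  rw [integral_add (by exact k1.add j3) j4, integral_add k1 j3,
    integral_div, integral_add i1 j2, integral_finsetSum _ fun t _ => i2 t,
    integral_finsetSum _ fun t _ => i4 t,
    integral_finsetSum _ fun t _ => integrable_finsetSum (Finset.range t) fun s _ => i3 t s]
  refine add_le_add (add_le_add (le_of_eq ?_) ?_) ?_
  -- The squared walk and the sum of squared innovations both have mean `n σ²`, so their half-sum
  -- does too.
  · rw [integral_law_comp_fst (F := fun e => centredWalk G n e ^ 2), integral_centredWalk_sq hL2]
    simp_rw [fun t => integral_law_comp_fst (θ := θ) (G := G)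
      (F := fun e => centredInnov G t e ^ 2), integral_centredInnov_sq]
    simp
  · simp_rw [fun t => integral_finsetSum (Finset.range t) fun s (_ : s ∈ Finset.range t) => i3 t s]
    refine sum_range_sum_range_le (by positivity) fun t ht s hs => ?_
    rw [integral_mul_lossBound (F := fun e => |centredInnov G t e|) (by fun_prop)
      (integrable_abs_centredInnov_mul hL2 s t)]
    exact mul_le_mul_of_nonneg_left (integral_abs_centredInnov_mul_le hL2 (hs.trans ht) t) hq
  · calc _ ≤ ∑ t ∈ Finset.range n, (1 - (θ : ℝ)) * secondMomentBound G n := by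
          refine Finset.sum_le_sum fun t ht => ?_
          have ht' := (Finset.mem_range.1 ht).le
          rw [integral_mul_lossBound (F := fun e => (cumInnov t e : ℝ)) (by fun_prop)
            (integrable_cumInnov_mul hL2 t t)]
          exact mul_le_mul_of_nonneg_left (integral_cumInnov_mul_le hL2 ht' ht') hq
      _ = _ := by simp

lemma integral_denominatorErr_le (hL2 : MemLp (fun k : ℕ => (k : ℝ)) 2 G) (n : ℕ) :
    ∫ ω, denominatorErr G n ω ∂(law θ G) ≤
      n * ((1 + √n) * (n * innovVar G) + (n * innovMean G) ^ 2 / √n) +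
        2 * (n ^ 2 * ((1 - θ) * secondMomentBound G n)) := by
  have hq : 0 ≤ 1 - (θ : ℝ) := sub_nonneg.2 θ.2.2
  have hV := innovVar_nonneg G
  have hM := secondMomentBound_nonneg G n
  have i1 (t : ℕ) : Integrable (fun e => (1 + √n) * centredWalk G t e ^ 2)
      (Measure.infinitePi fun _ => G) := (memLp_centredWalk hL2 t).integrable_sq.const_mul _
  have i2 (t : ℕ) : Integrable (fun ω : Space =>
      (1 + √n) * centredWalk G t ω.1 ^ 2 + (t * innovMean G) ^ 2 / √n) (law θ G) :=
    ((i1 t).add (integrable_const _)).comp_fst _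
  have i3 (t s : ℕ) : Integrable (fun ω : Space => (cumInnov t ω.1 : ℝ) * lossBound s ω)
      (law θ G) :=
    integrable_mul_lossBound (F := fun e => (cumInnov t e : ℝ)) (by fun_prop)
      (integrable_cumInnov_mul hL2 s t)
  have j2 := integrable_finsetSum (Finset.range n) fun t _ => i2 t
  have j3 := integrable_finsetSum (Finset.range n) fun t _ =>
    integrable_finsetSum (Finset.range t) fun s _ => i3 t s
  unfold denominatorErr
  rw [integral_add j2 (j3.const_mul 2), integral_const_mul, integral_finsetSum _ fun t _ => i2 t,
    integral_finsetSum _ fun t _ => integrable_finsetSum (Finset.range t) fun s _ => i3 t s]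
  refine add_le_add ?_ (mul_le_mul_of_nonneg_left ?_ zero_le_two)
  · calc _ ≤ ∑ t ∈ Finset.range n,
          ((1 + √n) * (n * innovVar G) + (n * innovMean G) ^ 2 / √n) := by
          refine Finset.sum_le_sum fun t ht => ?_
          have ht' : (t : ℝ) ≤ n := by exact_mod_cast (Finset.mem_range.1 ht).le
          have hμ : 0 ≤ innovMean G := integral_nonneg fun k => by positivity
          rw [integral_law_comp_fst (F := fun e =>
            (1 + √n) * centredWalk G t e ^ 2 + (t * innovMean G) ^ 2 / √n),
            integral_add (i1 t) (integrable_const _), integral_const_mul,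
            integral_centredWalk_sq hL2, integral_const]
          simp only [probReal_univ, one_smul]
          gcongr
      _ = _ := by simp [mul_add]
  · simp_rw [fun t => integral_finsetSum (Finset.range t) fun s (_ : s ∈ Finset.range t) => i3 t s]
    refine sum_range_sum_range_le (by positivity) fun t ht s hs => ?_
    rw [integral_mul_lossBound (F := fun e => (cumInnov t e : ℝ)) (by fun_prop)
      (integrable_cumInnov_mul hL2 s t)]
    exact mul_le_mul_of_nonneg_left (integral_cumInnov_mul_le hL2 (hs.trans ht).le ht.le) hq

end Thinning

end INAR

namespace INAR

/-! ### Asymptotics of the normalized numerator and denominator -/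

lemma tendsto_three_mul_sum_sq_div_cube :
    Tendsto (fun n : ℕ => 3 * (∑ t ∈ Finset.range n, (t : ℝ) ^ 2) / (n : ℝ) ^ 3) atTop (𝓝 1) := by
  have hsum (n : ℕ) : ∑ t ∈ Finset.range n, (t : ℝ) ^ 2 = n * (n - 1) * (2 * n - 1) / 6 := by
    induction n with
    | zero => simp
    | succ n ih => rw [Finset.sum_range_succ, ih]; push_cast; ring
  have hinv : Tendsto (fun n : ℕ => ((n : ℝ))⁻¹) atTop (𝓝 0) := tendsto_inv_atTop_nhds_zero_nat
  have hlim : Tendsto (fun n : ℕ => (1 - (n : ℝ)⁻¹) * (2 - (n : ℝ)⁻¹) / 2) atTop (𝓝 1) := by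
    have := ((hinv.const_sub 1).mul (hinv.const_sub 2)).div_const 2
    simpa using this
  refine hlim.congr' ?_
  filter_upwards [eventually_gt_atTop 0] with n hn
  have hn' : (n : ℝ) ≠ 0 := by positivity
  rw [hsum]
  field_simp
  ring

lemma tendsto_const_div_sqrt (c : ℝ) :
    Tendsto (fun n : ℕ => c / √(n : ℝ)) atTop (𝓝 0) :=
  (Real.tendsto_sqrt_atTop.comp tendsto_natCast_atTop_atTop).const_div_atTop c

/-- Weights of the standardized innovations in the leading term of the numerator. -/
noncomputable def leadingWeight (n t : ℕ) : ℝ := √3 * t / (n * √n)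

lemma leadingWeight_abs_le {n t : ℕ} (ht : t < n) : |leadingWeight n t| ≤ √3 / √n := by
  have hn : (0 : ℝ) < n := by exact_mod_cast (Nat.zero_le t).trans_lt ht
  have ht' : (t : ℝ) ≤ n := by exact_mod_cast ht.le
  have hs : 0 < √(n : ℝ) := Real.sqrt_pos.2 hn
  rw [leadingWeight, abs_of_nonneg (by positivity), div_le_div_iff₀ (by positivity) hs]
  have : √3 * t * √n ≤ √3 * n * √(n : ℝ) := by gcongr
  linarith

/-- The squares add up to `3 ∑ t² / n³`, which explains the factor `√3`. -/
lemma tendsto_sum_leadingWeight_sq :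
    Tendsto (fun n => ∑ t ∈ Finset.range n, leadingWeight n t ^ 2) atTop (𝓝 1) := by
  refine tendsto_three_mul_sum_sq_div_cube.congr fun n => ?_
  rw [Finset.mul_sum, Finset.sum_div]
  refine Finset.sum_congr rfl fun t _ => ?_
  rw [leadingWeight, div_pow, mul_pow, mul_pow, Real.sq_sqrt zero_le_three,
    Real.sq_sqrt (Nat.cast_nonneg n)]
  ring

lemma tendstoInDistribution_leadingTerm {G : Measure ℕ} [IsProbabilityMeasure G]
    (hL2 : MemLp (fun k : ℕ => (k : ℝ)) 2 G) (hvar : 0 < innovVar G) :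
    TendstoInDistribution (fun (n : ℕ) (e : ℕ → ℕ) =>
        ∑ t ∈ Finset.range n, leadingWeight n t * (centredInnov G t e / √(innovVar G)))
      atTop (id : ℝ → ℝ) (fun _ => Measure.infinitePi fun _ => G) (gaussianReal 0 1) := by
  refine tendstoInDistribution_weighted_sum (ξ := fun t e => centredInnov G t e / √(innovVar G))
    (iIndepFun_centredInnov.comp (fun _ x => x / √(innovVar G)) fun _ => by fun_prop)
    (fun t => (identDistrib_centredInnov t).comp (u := fun x => x / √(innovVar G)) (by fun_prop))
    ?_ ?_ (tendsto_const_div_sqrt √3) (fun n t ht => leadingWeight_abs_le ht)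
    tendsto_sum_leadingWeight_sq
  · rw [integral_div, integral_centredInnov hL2, zero_div]
  · simp only [Pi.pow_apply, div_pow]
    rw [integral_div, integral_centredInnov_sq, Real.sq_sqrt hvar.le, div_self hvar.ne']

/-- Normalized denominator `3 μ_G⁻² n⁻³ ∑ X_t²`. -/
noncomputable def normalizedDenominator (G : Measure ℕ) (n : ℕ) (ω : Space) : ℝ :=
  3 / (innovMean G ^ 2 * n ^ 3) * ∑ t ∈ Finset.range n, (X t ω : ℝ) ^ 2

/-- Normalizing factor of the numerator. -/
noncomputable def numeratorScale (G : Measure ℕ) (n : ℕ) : ℝ :=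
  √3 / (√(innovVar G) * innovMean G * (n * √n))

@[fun_prop]
lemma measurable_normalizedDenominator (G : Measure ℕ) (n : ℕ) :
    Measurable (normalizedDenominator G n) := by
  unfold normalizedDenominator; fun_prop

@[fun_prop]
lemma measurable_olsNumerator (G : Measure ℕ) (n : ℕ) : Measurable (olsNumerator G n) := by
  unfold olsNumerator; fun_prop

@[fun_prop]
lemma measurable_dickeyFuller (G : Measure ℕ) (n : ℕ) : Measurable (dickeyFuller G n) := by
  unfold dickeyFuller olsEstimator; fun_prop

lemma dickeyFuller_eq {G : Measure ℕ} (hμ : 0 < innovMean G) (hvar : 0 < innovVar G) (n : ℕ)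
    (ω : Space) : dickeyFuller G n ω =
      numeratorScale G n * olsNumerator G n ω * (√(normalizedDenominator G n ω))⁻¹ := by
  have hnum : olsNumerator G n ω =
      ∑ t ∈ Finset.range n, (X t ω : ℝ) * ((X (t + 1) ω : ℝ) - innovMean G) -
        ∑ t ∈ Finset.range n, (X t ω : ℝ) ^ 2 := by
    rw [olsNumerator, ← Finset.sum_sub_distrib]
    exact Finset.sum_congr rfl fun t _ => by ring
  rw [dickeyFuller, olsEstimator, numeratorScale, normalizedDenominator, hnum]
  set S := ∑ t ∈ Finset.range n, (X t ω : ℝ) ^ 2 with hS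
  set A := ∑ t ∈ Finset.range n, (X t ω : ℝ) * ((X (t + 1) ω : ℝ) - innovMean G)
  have hS0 : 0 ≤ S := Finset.sum_nonneg fun _ _ => sq_nonneg _
  -- If `S = 0`, both sides vanish by the convention for division by zero, in agreement with the
  -- value `0` assigned to the statistic.
  rcases hS0.eq_or_lt with h0 | hpos
  · simp [← h0]
  · have hn : 0 < n := by
      rcases Nat.eq_zero_or_pos n with rfl | hn
      · simp [hS] at hpos
      · exact hn
    have hn' : (0 : ℝ) < n := by exact_mod_cast hn
    have hsn : 0 < √(n : ℝ) := Real.sqrt_pos.2 hn'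
    have hsS : 0 < √S := Real.sqrt_pos.2 hpos
    have hsV : 0 < √(innovVar G) := Real.sqrt_pos.2 hvar
    have hB : √(3 / (innovMean G ^ 2 * (n : ℝ) ^ 3) * S) =
        √3 * √S / (innovMean G * (n * √n)) := by
      rw [Real.sqrt_eq_iff_mul_self_eq_of_pos (by positivity)]
      have h3 := Real.mul_self_sqrt (zero_le_three (α := ℝ))
      have h4 := Real.mul_self_sqrt hn'.le
      have h5 := Real.mul_self_sqrt hpos.le
      rw [div_mul_div_comm, show √3 * √S * (√3 * √S) = (√3 * √3) * (√S * √S) by ring,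
        show innovMean G * (n * √(n : ℝ)) * (innovMean G * (n * √(n : ℝ))) =
          innovMean G ^ 2 * n ^ 2 * (√(n : ℝ) * √(n : ℝ)) by ring, h3, h4, h5]
      ring
    have hD : √(innovVar G * S⁻¹) = √(innovVar G) / √S := by
      rw [Real.sqrt_mul hvar.le, Real.sqrt_inv, div_eq_mul_inv]
    have h5 : S = √S * √S := (Real.mul_self_sqrt hpos.le).symm
    rw [hB, hD, show A / S - 1 = (A - S) / S by field_simp]
    have h3 : √(3 : ℝ) ≠ 0 := by positivity
    generalize hr : √S = r at *
    rw [h5]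
    field_simp

lemma secondMomentBound_le (G : Measure ℕ) {n : ℕ} (hn : 0 < n) :
    secondMomentBound G n ≤ 2 * (innovVar G + innovMean G ^ 2) * n ^ 2 := by
  have hV := innovVar_nonneg G
  have hn1 : (1 : ℝ) ≤ n := by exact_mod_cast hn
  unfold secondMomentBound
  nlinarith [mul_nonneg hV (mul_nonneg (sub_nonneg.2 hn1) (zero_le_one.trans hn1))]

/-- Normalized remainder of the numerator. -/
noncomputable def numeratorRemainder (G : Measure ℕ) (n : ℕ) (ω : Space) : ℝ :=
  numeratorScale G n * (olsNumerator G n ω -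
    innovMean G * ∑ t ∈ Finset.range n, (t : ℝ) * centredInnov G t ω.1)

@[fun_prop]
lemma measurable_numeratorRemainder (G : Measure ℕ) (n : ℕ) :
    Measurable (numeratorRemainder G n) := by
  unfold numeratorRemainder; fun_prop

lemma scaled_olsNumerator_eq {G : Measure ℕ} (hμ : 0 < innovMean G) (n : ℕ) (ω : Space) :
    numeratorScale G n * olsNumerator G n ω =
      ∑ t ∈ Finset.range n, leadingWeight n t * (centredInnov G t ω.1 / √(innovVar G)) +
        numeratorRemainder G n ω := by
  have hsum : ∑ t ∈ Finset.range n, leadingWeight n t * (centredInnov G t ω.1 / √(innovVar G)) =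
      numeratorScale G n *
        (innovMean G * ∑ t ∈ Finset.range n, (t : ℝ) * centredInnov G t ω.1) := by
    rw [Finset.mul_sum, Finset.mul_sum]
    refine Finset.sum_congr rfl fun t _ => ?_
    rw [leadingWeight, numeratorScale]
    field_simp
  rw [hsum, numeratorRemainder]
  ring

/-! ### Limits under the local alternatives -/

section Limits

variable {G : Measure ℕ} [IsProbabilityMeasure G] {h : ℝ} {θ : ℕ → unitInterval}

lemma integral_numeratorErr_le_linear (hL2 : MemLp (fun k : ℕ => (k : ℝ)) 2 G) (hh : 0 ≤ h)
    {n : ℕ} (hn : 0 < n) {p : unitInterval} (hp : (p : ℝ) = 1 - h / (n : ℝ) ^ 2) :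
    ∫ ω, numeratorErr G n ω ∂(law p G) ≤
      (innovVar G + h * innovVar G + 4 * h * (innovVar G + innovMean G ^ 2)) * n := by
  have hM := secondMomentBound_le G hn
  have hn' : (0 : ℝ) < n := by exact_mod_cast hn
  refine (integral_numeratorErr_le hL2 n).trans ?_
  rw [hp, sub_sub_cancel]
  calc _ = n * innovVar G + h * (n * innovVar G) + 2 * h / n * secondMomentBound G n := by
        field_simp; ring
    _ ≤ n * innovVar G + h * (n * innovVar G) +
        2 * h / n * (2 * (innovVar G + innovMean G ^ 2) * n ^ 2) := by gcongr
    _ = _ := by field_simp; ring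

lemma integral_denominatorErr_le_rate (hL2 : MemLp (fun k : ℕ => (k : ℝ)) 2 G) (hh : 0 ≤ h)
    {n : ℕ} (hn : 0 < n) {p : unitInterval} (hp : (p : ℝ) = 1 - h / (n : ℝ) ^ 2) :
    ∫ ω, denominatorErr G n ω ∂(law p G) ≤
      (2 * innovVar G + innovMean G ^ 2 + 4 * h * (innovVar G + innovMean G ^ 2)) *
        (n ^ 3 / √n) := by
  have hM := secondMomentBound_le G hn
  have hV := innovVar_nonneg G
  have hn' : (0 : ℝ) < n := by exact_mod_cast hn
  have hs : 0 < √(n : ℝ) := Real.sqrt_pos.2 hn'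
  have hs1 : 1 ≤ √(n : ℝ) := Real.one_le_sqrt.2 (by exact_mod_cast hn)
  have hss := Real.mul_self_sqrt hn'.le
  have hdiv : (n : ℝ) ^ 3 / √n = n ^ 2 * √n := by
    rw [div_eq_iff hs.ne', mul_assoc, hss]; ring
  refine (integral_denominatorErr_le hL2 n).trans ?_
  rw [hp, sub_sub_cancel]
  calc _ = (1 + √n) * (n ^ 2 * innovVar G) + innovMean G ^ 2 * (n ^ 3 / √n) +
        2 * h * secondMomentBound G n := by
        field_simp
    _ ≤ (√n + √n) * (n ^ 2 * innovVar G) + innovMean G ^ 2 * (n ^ 3 / √n) +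
        2 * h * (2 * (innovVar G + innovMean G ^ 2) * (n ^ 2 * √n)) := by
        -- The loss term is only of order `n²`; it is enlarged to the common rate `n^{5/2}`.
        have : (n : ℝ) ^ 2 ≤ n ^ 2 * √n := le_mul_of_one_le_right (by positivity) hs1
        have h2 : secondMomentBound G n ≤
            2 * (innovVar G + innovMean G ^ 2) * (n ^ 2 * √n) :=
          hM.trans (mul_le_mul_of_nonneg_left this (by positivity))
        gcongr
    _ = _ := by rw [hdiv]; ring

/-- The `L¹` error is linear in `n` against a scale of order `n^{-3/2}`, leaving a multiple of `1 /
√n` for Markov's inequality. -/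
lemma tendstoInMeasure_numeratorRemainder (hL2 : MemLp (fun k : ℕ => (k : ℝ)) 2 G)
    (hvar : 0 < innovVar G) (hh : 0 ≤ h)
    (hθ : ∀ᶠ n : ℕ in atTop, (θ n : ℝ) = 1 - h / (n : ℝ) ^ 2) :
    TendstoInMeasure (Measure.infinitePi fun n => law (θ n) G)
      (fun n ω => numeratorRemainder G n (ω n)) atTop fun _ => 0 := by
  have hμ := innovMean_pos hvar
  have hscale n : 0 ≤ numeratorScale G n := by unfold numeratorScale; positivity
  have hint n : Integrable (numeratorErr G n) (law (θ n) G) := integrable_numeratorErr hL2 n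
  refine tendstoInMeasure_infinitePi_of_integral_le
    (fun n => (hint n).const_mul (numeratorScale G n))
    (fun n => ?_) ?_ (tendsto_const_div_sqrt
      (√3 * (innovVar G + h * innovVar G + 4 * h * (innovVar G + innovMean G ^ 2)) /
        (√(innovVar G) * innovMean G)))
  · filter_upwards [ae_law_thinning_le_one] with ω hω
    rw [sub_zero, numeratorRemainder, abs_mul, abs_of_nonneg (hscale n)]
    exact mul_le_mul_of_nonneg_left (abs_olsNumerator_sub_le G hω n) (hscale n)
  · filter_upwards [hθ, eventually_gt_atTop 0] with n hn hn0
    rw [integral_const_mul]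
    refine (mul_le_mul_of_nonneg_left (integral_numeratorErr_le_linear hL2 hh hn0 hn)
      (hscale n)).trans (le_of_eq ?_)
    have hn' : (n : ℝ) ≠ 0 := by positivity
    have hs : √(n : ℝ) ≠ 0 := by positivity
    rw [numeratorScale]
    field_simp

lemma tendstoInMeasure_normalizedDenominator (hL2 : MemLp (fun k : ℕ => (k : ℝ)) 2 G)
    (hvar : 0 < innovVar G) (hh : 0 ≤ h)
    (hθ : ∀ᶠ n : ℕ in atTop, (θ n : ℝ) = 1 - h / (n : ℝ) ^ 2) :
    TendstoInMeasure (Measure.infinitePi fun n => law (θ n) G)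
      (fun n ω => normalizedDenominator G n (ω n)) atTop fun _ => 1 := by
  have hμ := innovMean_pos hvar
  have hint n : Integrable (denominatorErr G n) (law (θ n) G) := integrable_denominatorErr hL2 n
  -- The deterministic error made in replacing `∑ t²` by `n³ / 3`.
  set d : ℕ → ℝ := fun n => |3 * (∑ t ∈ Finset.range n, (t : ℝ) ^ 2) / (n : ℝ) ^ 3 - 1|
  have hd : Tendsto d atTop (𝓝 0) := by
    simpa using (tendsto_three_mul_sum_sq_div_cube.sub_const 1).abs
  have hlim := (tendsto_const_div_sqrt (3 * (2 * innovVar G + innovMean G ^ 2 +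
    4 * h * (innovVar G + innovMean G ^ 2)) / innovMean G ^ 2)).add hd
  rw [add_zero] at hlim
  have hintc n := (hint n).const_mul (3 / (innovMean G ^ 2 * n ^ 3))
  refine tendstoInMeasure_infinitePi_of_integral_le
    (g := fun n ω => 3 / (innovMean G ^ 2 * n ^ 3) * denominatorErr G n ω + d n)
    (fun n => (hintc n).add (integrable_const _)) (fun n => ?_) ?_ hlim
  · filter_upwards [ae_law_thinning_le_one] with ω hω
    have hsplit : normalizedDenominator G n ω - 1 =
        3 / (innovMean G ^ 2 * n ^ 3) * (∑ t ∈ Finset.range n, (X t ω : ℝ) ^ 2 -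
          innovMean G ^ 2 * ∑ t ∈ Finset.range n, (t : ℝ) ^ 2) +
        (3 * (∑ t ∈ Finset.range n, (t : ℝ) ^ 2) / (n : ℝ) ^ 3 - 1) := by
      rw [normalizedDenominator]
      field_simp
      ring
    rw [hsplit]
    refine (abs_add_le _ _).trans (add_le_add ?_ le_rfl)
    have hpos : 0 ≤ 3 / (innovMean G ^ 2 * (n : ℝ) ^ 3) := by positivity
    rw [abs_mul, abs_of_nonneg hpos]
    exact mul_le_mul_of_nonneg_left (abs_sum_X_sq_sub_le G hω n) hpos
  · filter_upwards [hθ, eventually_gt_atTop 0] with n hn hn0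
    rw [integral_add (hintc n) (integrable_const _), integral_const_mul, integral_const,
      probReal_univ, one_smul]
    refine add_le_add ((mul_le_mul_of_nonneg_left (integral_denominatorErr_le_rate hL2 hh hn0 hn)
      (by positivity)).trans (le_of_eq ?_)) le_rfl
    have hn' : (n : ℝ) ≠ 0 := by positivity
    have hs : √(n : ℝ) ≠ 0 := by positivity
    field_simp

/-- Slutsky's theorem needs one probability space, so the `n`-th experiment is placed on the `n`-th
coordinate of a product. Their joint law is immaterial, since the conclusion concerns only the
marginals. -/
theorem tendstoInDistribution_dickeyFuller (hL2 : MemLp (fun k : ℕ => (k : ℝ)) 2 G)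
    (hvar : 0 < innovVar G) (hh : 0 ≤ h)
    (hθ : ∀ᶠ n : ℕ in atTop, (θ n : ℝ) = 1 - h / (n : ℝ) ^ 2) :
    TendstoInDistribution (fun n => dickeyFuller G n) atTop (id : ℝ → ℝ)
      (fun n => law (θ n) G) (gaussianReal 0 1) := by
  have hμ := innovMean_pos hvar
  set P := Measure.infinitePi fun n => law (θ n) G with hP
  have hev (n : ℕ) : MeasurePreserving (fun ω : ℕ → Space => ω n) P (law (θ n) G) :=
    measurePreserving_eval_infinitePi (fun n => law (θ n) G) n
  have hmeas (n : ℕ) : Measurable fun e : ℕ → ℕ =>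
      ∑ t ∈ Finset.range n, leadingWeight n t * (centredInnov G t e / √(innovVar G)) := by
    fun_prop
  have hfst (n : ℕ) : MeasurePreserving (fun ω : ℕ → Space => (ω n).1) P
      (Measure.infinitePi fun _ => G) := measurePreserving_fst.comp (hev n)
  -- The leading term involves the innovations alone, whose law does not depend on `θ n`.
  have hlead : TendstoInDistribution (fun n (ω : ℕ → Space) =>
      ∑ t ∈ Finset.range n, leadingWeight n t * (centredInnov G t (ω n).1 / √(innovVar G)))
      atTop (id : ℝ → ℝ) (fun _ => P) (gaussianReal 0 1) := by
    refine tendstoInDistribution_of_map_eq (tendstoInDistribution_leadingTerm hL2 hvar)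
      (fun n => ((hmeas n).comp (hfst n).measurable).aemeasurable) fun n => ?_
    rw [← (hfst n).map_eq, Measure.map_map (hmeas n) (hfst n).measurable]
    rfl
  have hnum := hlead.add_of_tendstoInMeasure_const
    (tendstoInMeasure_numeratorRemainder hL2 hvar hh hθ)
    fun n => ((measurable_numeratorRemainder G n).comp (hev n).measurable).aemeasurable
  have hcont : ContinuousAt (fun x : ℝ => (√x)⁻¹) 1 :=
    Real.continuous_sqrt.continuousAt.inv₀ (by simp)
  have hden := (tendstoInMeasure_normalizedDenominator hL2 hvar hh hθ).comp_continuousAt_const hcont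
  have hprod := hnum.continuous_comp_prodMk_of_tendstoInMeasure_const
    (g := fun p : ℝ × ℝ => p.1 * p.2) (by fun_prop) hden
    fun n => (((measurable_normalizedDenominator G n).comp (hev n).measurable).sqrt.inv).aemeasurable
  have hcommon : TendstoInDistribution (fun n (ω : ℕ → Space) => dickeyFuller G n (ω n)) atTop
      (id : ℝ → ℝ) (fun _ => P) (gaussianReal 0 1) := by
    refine TendstoInDistribution.congr (fun n => ae_of_all _ fun ω => ?_)
      (ae_of_all _ fun x => ?_) hprod
    · beta_reduce
      rw [dickeyFuller_eq hμ hvar, scaled_olsNumerator_eq hμ]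
      rfl
    · simp
  refine tendstoInDistribution_of_map_eq hcommon
    (fun n => (measurable_dickeyFuller G n).aemeasurable) fun n => ?_
  rw [← (hev n).map_eq, Measure.map_map (measurable_dickeyFuller G n) (hev n).measurable]
  rfl

end Limits

end INAR

/-- The parameter `1 - h / n²` is a probability only for `n² ≥ h`, so `θ n` is required to be
equal to it for all large `n`. -/
theorem proposition4p5 (G : Measure ℕ) [IsProbabilityMeasure G]
    (hG3 : Integrable (fun k : ℕ => (k : ℝ) ^ 3) G) (hGvar : 0 < INAR.innovVar G)
    (h : ℝ) (hh : 0 ≤ h) (θ : ℕ → unitInterval)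
    (hθ : ∀ᶠ n : ℕ in atTop, (θ n : ℝ) = 1 - h / (n : ℝ) ^ 2) :
    TendstoInDistribution (fun n => INAR.dickeyFuller G n) atTop (id : ℝ → ℝ)
        (fun n => INAR.law (θ n) G) (gaussianReal 0 1) ∧
      ∀ α : ℝ, 0 < α → α < 1 →
        Tendsto (fun n : ℕ => (INAR.law (θ n) G).real (INAR.rejects G α n)) atTop (𝓝 α) := by
  have hlim := INAR.tendstoInDistribution_dickeyFuller
    (INAR.memLp_two_of_integrable_pow_three hG3) hGvar hh hθ
  refine ⟨hlim, fun α h0 h1 => ?_⟩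
  have hna : NullSingletonClass (gaussianReal 0 1) := nullSingletonClass_gaussianReal one_ne_zero
  -- Portmanteau theorem: the boundary of the half-line is a single point, which is Gaussian-null.
  have hIio : Tendsto (fun n => (INAR.law (θ n) G).map (INAR.dickeyFuller G n)
      (Set.Iio (INAR.normalQuantile α))) atTop
      (𝓝 (gaussianReal 0 1 (Set.Iio (INAR.normalQuantile α)))) := by
    simpa using ProbabilityMeasure.tendsto_measure_of_null_frontier_of_tendsto' hlim.tendsto
      (E := Set.Iio (INAR.normalQuantile α)) (by simp)
  have hreal := (ENNReal.tendsto_toReal (measure_ne_top _ _)).comp hIio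
  rw [← Measure.real, INAR.gaussianReal_Iio_normalQuantile h0 h1] at hreal
  refine hreal.congr fun n => ?_
  simp only [Function.comp_apply]
  rw [Measure.map_apply (INAR.measurable_dickeyFuller G n) measurableSet_Iio]
  rfl
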